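/- **Identification of the average marginal policy effect.** Let $D$ be a real policy variable, $X$ a random vector in $\mathbb{R}^k$, $\varepsilon$ a random disturbance in a measurable space, $Y=m(D,X,\varepsilon)$ with $m$ measurable and $m(d,x,e)$ continuously differentiable in $d$. For $t\in[0,1]$ let $\pi_t:\mathbb{R}\to\mathbb{R}$ be measurable, $\pi_0(d)=d$, with $\pi_t(d)$ continuously differentiable in $t$ at $t=0$ and $\dot\pi(d)=\partial_t\pi_t(d)|_{t=0}$ bounded (both for $d\in\operatorname{supp}D$); put $Y^t=m(\pi_t(D),X,\varepsilon)$ and $\dot m(d,x,e)=\dot\pi(d)\,\partial_d m(d,x,e)$. Conditions below that are imposed on the support of (conditional) laws of $Y$ are required on its interior only. Assume: 1. The law of $D$ is absolutely continuous, and $D$ is almost surely in the interior of $\operatorname{supp}D$. 2. $Y$ has a density $f_Y$; on $\operatorname{supp}Y$, $F_Y$ is continuously differentiable with derivative $f_Y>0$. 3. $\dot m$ is measurable, and for all $\nu>0$, $\mathbb{P}[\,|Y^t-Y-t\,\dot m(D,X,\varepsilon)|\ge\nu t\,]=o(t)$ as $t\downarrow0$. 4. $(Y,\dot m(D,X,\varepsilon))$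 has a density $f(y,y')$, continuous in $y$ on $\operatorname{supp}Y$ for each $y'$, with $f(y,y')\le C|g(y')|$ for all $(y,y')$, for some $C>0$ and some $g$ with $\int|g(y')|\,dy'<\infty$ and $\int|y'g(y')|\,dy'<\infty$. 5. $\varepsilon$ is independent of $D$ given $X$: there is a conditional distribution $F_{\varepsilon|D,X}(\cdot|d,x)$ of $\varepsilon$ given $(D,X)$ that does not depend on $d$ for $(d,x)\in\operatorname{supp}D\times\operatorname{supp}X$. Conditional probabilities given $D=d,X=x$ are computed with this version; in particular $F_{Y|D,X}(\cdot|d,x)$ is the distribution function, and $\mathbb{E}[Y|D=d,X=x]$ the mean, of $m(d,x,\varepsilon)$ under it. 6. For all $(d,x)\in\operatorname{supp}D\times\operatorname{supp}X$: (a) $F_{Y|D,X}(\cdot|d,x)$ has a density $f_{Y|D,X}(\cdot|d,x)$ (jointly measurable in all arguments), positive, bounded and continuous on its support, and for each $(y,x)$, $F_{Y|D,X}(y|d,x)$ is continuously differentiable in $d$ in the interior of $\operatorname{supp}D$; (b) $\partial_d m(d,x,\cdot)$ is measurable, and for all $\nu>0$, $\mathbb{P}[\,|m(d+\delta,x,\varepsilon)-m(d,x,\varepsilon)-\delta\,\partial_d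 m(d,x,\varepsilon)|\ge\nu\delta\mid D=d,X=x]=o(\delta)$ as $\delta\downarrow0$; (c) the law of $(m(d,x,\varepsilon),\partial_d m(d,x,\varepsilon))$ given $D=d,X=x$ has a density continuous in $y$ on the conditional support of $Y$ for each $y'$ and bounded by $C|g(y')|$, with $C$ and $g$ as in 4 (possibly different ones), not depending on $(d,x)$. 7. $\operatorname{supp}Y$ is compact, and some compact set carries the law of $Y^t$ for all small $t>0$ and the conditional law of $Y$ given $D=d,X=x$ for all $(d,x)\in\operatorname{supp}D\times\operatorname{supp}X$. Let $\beta(d,x,y)=-\dfrac{\partial_dF_{Y|D,X}(y|d,x)}{f_{Y|D,X}(y|d,x)}$. Then almost surely $d\mapsto\mathbb{E}[Y|D=d,X=x]$ is differentiable at $d=D$ for $x=X$, the variables $\dot\pi(D)\beta(D,X,Y)$ and $\dot\pi(D)\,\partial_d\mathbb{E}[Y|D,X]$ are integrable, and the limit $\theta_\mu=\lim_{t\downarrow0}\frac{\mu(F_{Y^t})-\mu(F_Y)}{t}$, where $\mu(F)=\int y\,dF(y)$, exists and satisfies $$\theta_\mu=\mathbb{E}\big[\dot\pi(D)\,\beta(D,X,Y)\big]=\mathbb{E}\big[\dot\pi(D)\,\partial_d\mathbb{E}[Y|D,X]\big].$$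 -/

import Mathlib

open MeasureTheory ProbabilityTheory Filter Topology Asymptotics

noncomputable section

namespace MPE

/-! ### Functionals of distributions and marginal policy effects -/

/-- The mean functional `F ↦ ∫ y dF(y)` on cumulative distribution functions. -/
def meanFunctional (F : StieltjesFunction ℝ) : ℝ := ∫ y, y ∂F.measure

/-- The cumulative distribution function `F_Z(y) = P[Z ≤ y]` of a real random variable. -/
def cdfOf {Ω : Type*} [MeasurableSpace Ω] (P : Measure Ω) (Z : Ω → ℝ) : StieltjesFunction ℝ :=
  cdf (P.map Z)

/-- `θ` is the marginal policy effect on `Γ` of passing from the outcome `Y` to the counterfactual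
outcomes `Yt t`: the limit of `(Γ(F_{Y^t}) - Γ(F_Y)) / t` as `t ↓ 0` exists and equals `θ`. -/
def IsMarginalPolicyEffect {Ω : Type*} [MeasurableSpace Ω] (P : Measure Ω)
    (Γ : StieltjesFunction ℝ → ℝ) (Y : Ω → ℝ) (Yt : ℝ → Ω → ℝ) (θ : ℝ) : Prop :=
  Tendsto (fun t : ℝ => (Γ (cdfOf P (Yt t)) - Γ (cdfOf P Y)) / t) (𝓝[>] 0) (𝓝 θ)

/-! ### The nonseparable model -/

variable {Ω E : Type*} [MeasurableSpace Ω] [MeasurableSpace E] {k : ℕ}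

/-- The status quo outcome `Y = m(D, X, ε)`. -/
def outcome (m : ℝ → (Fin k → ℝ) → E → ℝ) (D : Ω → ℝ) (X : Ω → Fin k → ℝ) (ε : Ω → E) (ω : Ω) :
    ℝ :=
  m (D ω) (X ω) (ε ω)

/-- The counterfactual outcome `Y^t = m(π_t(D), X, ε)`. -/
def cfOutcome (m : ℝ → (Fin k → ℝ) → E → ℝ) (π : ℝ → ℝ → ℝ) (D : Ω → ℝ) (X : Ω → Fin k → ℝ)
    (ε : Ω → E) (t : ℝ) (ω : Ω) : ℝ :=
  m (π t (D ω)) (X ω) (ε ω)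

/-- The structural derivative `∂_d m(d, x, e)`. -/
def structDeriv (m : ℝ → (Fin k → ℝ) → E → ℝ) (d : ℝ) (x : Fin k → ℝ) (e : E) : ℝ :=
  deriv (fun s => m s x e) d

/-- `π̇(d) = ∂_t π_t(d)` at `t = 0`, where `t` ranges over `[0, 1]`. -/
def policyDeriv (π : ℝ → ℝ → ℝ) (d : ℝ) : ℝ :=
  derivWithin (fun t => π t d) (Set.Icc 0 1) 0

/-- `ṁ(d, x, e) = π̇(d) ∂_d m(d, x, e)`. -/
def responseDeriv (m : ℝ → (Fin k → ℝ) → E → ℝ) (π : ℝ → ℝ → ℝ) (d : ℝ) (x : Fin k → ℝ) (e : E) :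
    ℝ :=
  policyDeriv π d * structDeriv m d x e

/-- The structural assumptions: `m` is measurable and continuously differentiable in `d`, the
policy variable `D` is continuously distributed and almost surely interior to its support (so that
derivatives in `d` make sense at `D`), and the policy functions `π_t`, `t ∈ [0, 1]`, start at the
status quo and are continuously differentiable in `t` at `t = 0` with bounded derivative. -/
structure StructuralModel (P : Measure Ω) (m : ℝ → (Fin k → ℝ) → E → ℝ) (π : ℝ → ℝ → ℝ)
    (D : Ω → ℝ) (X : Ω → Fin k → ℝ) (ε : Ω → E) : Prop where
  measurable_D : Measurable D
  measurable_X : Measurable X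
  measurable_ε : Measurable ε
  measurable_m : Measurable fun p : ℝ × (Fin k → ℝ) × E => m p.1 p.2.1 p.2.2
  contDiff_m : ∀ x e, ContDiff ℝ 1 fun d => m d x e
  continuous_D : P.map D ≪ volume
  interior_D : ∀ᵐ ω ∂P, D ω ∈ interior (P.map D).support
  measurable_π : ∀ t ∈ Set.Icc (0 : ℝ) 1, Measurable (π t)
  π_zero : ∀ d, π 0 d = d
  differentiable_π : ∀ d ∈ (P.map D).support, ∀ᶠ t in 𝓝[Set.Icc 0 1] (0 : ℝ),
    DifferentiableWithinAt ℝ (fun s => π s d) (Set.Icc 0 1) t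
  continuous_deriv_π : ∀ d ∈ (P.map D).support,
    ContinuousWithinAt (derivWithin (fun s => π s d) (Set.Icc 0 1)) (Set.Icc 0 1) 0
  bounded_policyDeriv : ∃ B : ℝ, ∀ d ∈ (P.map D).support, |policyDeriv π d| ≤ B

/-- The law `ρ` on `ℝ × ℝ` is absolutely continuous with a density `f(y, y')` that is continuous
in `y` on the interior of `S` for each `y'`, and bounded by `C |g(y')|`. -/
def HasDominatedDensity (ρ : Measure (ℝ × ℝ)) (S : Set ℝ) (C : ℝ) (g : ℝ → ℝ) : Prop :=
  ∃ f : ℝ → ℝ → ℝ, Measurable (fun p : ℝ × ℝ => f p.1 p.2) ∧ (∀ y y', 0 ≤ f y y') ∧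
    ρ = volume.withDensity (fun p : ℝ × ℝ => ENNReal.ofReal (f p.1 p.2)) ∧
    (∀ y', ContinuousOn (fun y => f y y') (interior S)) ∧
    ∀ y y', f y y' ≤ C * |g y'|

/-- Regularity of the unconditional distributions. Conditions imposed on the support of `Y` are
required at the interior points of the support only: a density that vanishes continuously at the
ends of a compact support is allowed. -/
structure Regularity (P : Measure Ω) (m : ℝ → (Fin k → ℝ) → E → ℝ) (π : ℝ → ℝ → ℝ)
    (D : Ω → ℝ) (X : Ω → Fin k → ℝ) (ε : Ω → E) : Prop where
  density_Y : ∃ fY : ℝ → ℝ, Measurable fY ∧ (∀ y, 0 ≤ fY y) ∧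
    P.map (outcome m D X ε) = volume.withDensity (fun y => ENNReal.ofReal (fY y)) ∧
    (∀ y ∈ interior (P.map (outcome m D X ε)).support,
      HasDerivAt (fun z => cdfOf P (outcome m D X ε) z) (fY y) y ∧ 0 < fY y) ∧
    ContinuousOn fY (interior (P.map (outcome m D X ε)).support)
  measurable_response :
    Measurable fun p : ℝ × (Fin k → ℝ) × E => responseDeriv m π p.1 p.2.1 p.2.2
  expansion : ∀ ν : ℝ, 0 < ν →
    (fun t : ℝ => P.real {ω | ν * t ≤ |cfOutcome m π D X ε t ω - outcome m D X ε ω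
      - t * responseDeriv m π (D ω) (X ω) (ε ω)|}) =o[𝓝[>] 0] (fun t : ℝ => t)
  joint_density : ∃ (C : ℝ) (g : ℝ → ℝ), 0 < C ∧ Integrable g ∧ Integrable (fun y' => y' * g y') ∧
    HasDominatedDensity
      (P.map fun ω => (outcome m D X ε ω, responseDeriv m π (D ω) (X ω) (ε ω)))
      (P.map (outcome m D X ε)).support C g

/-! ### Conditional distributions given `(D, X)` -/

/-- `κ` is a version of the conditional distribution of `ε` given `(D, X)`: the law of
`((D, X), ε)` is the composition-product of the law of `(D, X)` with `κ`. -/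
def IsCondDistribOf (P : Measure Ω) (D : Ω → ℝ) (X : Ω → Fin k → ℝ) (ε : Ω → E)
    (κ : Kernel (ℝ × (Fin k → ℝ)) E) : Prop :=
  P.map (fun ω => ((D ω, X ω), ε ω)) = (P.map fun ω => (D ω, X ω)) ⊗ₘ κ

/-- Conditional independence of `ε` and `D` given `X`, read off the conditional distribution `κ` of
`ε` given `(D, X)`: on the supports, it does not depend on the value of `D`, that is
`F_{ε|D,X}(·|d, x) = F_{ε|X}(·|x)`. -/
def CondIndepOfPolicy (P : Measure Ω) (D : Ω → ℝ) (X : Ω → Fin k → ℝ)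
    (κ : Kernel (ℝ × (Fin k → ℝ)) E) : Prop :=
  ∃ η : Kernel (Fin k → ℝ) E, ∀ d ∈ (P.map D).support, ∀ x ∈ (P.map X).support, κ (d, x) = η x

/-- The conditional law of `Y = m(D, X, ε)` given `D = d` and `X = x`. -/
def condLaw (m : ℝ → (Fin k → ℝ) → E → ℝ) (κ : Kernel (ℝ × (Fin k → ℝ)) E) (d : ℝ)
    (x : Fin k → ℝ) : Measure ℝ :=
  (κ (d, x)).map (m d x)

/-- The conditional distribution function `F_{Y|D,X}(y|d, x)`. -/
def condCdf (m : ℝ → (Fin k → ℝ) → E → ℝ) (κ : Kernel (ℝ × (Fin k → ℝ)) E) (y d : ℝ)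
    (x : Fin k → ℝ) : ℝ :=
  cdf (condLaw m κ d x) y

/-- The conditional mean `E[Y | D = d, X = x]`. -/
def condMean (m : ℝ → (Fin k → ℝ) → E → ℝ) (κ : Kernel (ℝ × (Fin k → ℝ)) E) (d : ℝ)
    (x : Fin k → ℝ) : ℝ :=
  ∫ y, y ∂(condLaw m κ d x)

/-- `β(d, x, y) = - ∂_d F_{Y|D,X}(y|d, x) / f_{Y|D,X}(y|d, x)`, where `f d x y` is the conditional
density. -/
def beta (m : ℝ → (Fin k → ℝ) → E → ℝ) (κ : Kernel (ℝ × (Fin k → ℝ)) E)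
    (f : ℝ → (Fin k → ℝ) → ℝ → ℝ) (d : ℝ) (x : Fin k → ℝ) (y : ℝ) : ℝ :=
  -(deriv (fun s => condCdf m κ y s x) d / f d x y)

/-- Regularity of the conditional distributions given `(D, X)`; `f d x y` is the conditional
density of `Y` at `y` given `D = d`, `X = x`. The constant `C` and the function `g` do not depend
on `(d, x)`. Conditions imposed on a support are required at its interior points only. -/
structure CondRegularity (P : Measure Ω) (m : ℝ → (Fin k → ℝ) → E → ℝ)
    (D : Ω → ℝ) (X : Ω → Fin k → ℝ) (κ : Kernel (ℝ × (Fin k → ℝ)) E)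
    (f : ℝ → (Fin k → ℝ) → ℝ → ℝ) : Prop where
  measurable_f : Measurable fun p : ℝ × (Fin k → ℝ) × ℝ => f p.1 p.2.1 p.2.2
  nonneg_f : ∀ d x y, 0 ≤ f d x y
  density : ∀ d ∈ (P.map D).support, ∀ x ∈ (P.map X).support,
    condLaw m κ d x = volume.withDensity (fun y => ENNReal.ofReal (f d x y)) ∧
    (∀ y ∈ interior (condLaw m κ d x).support, 0 < f d x y) ∧
    (∃ M : ℝ, ∀ y ∈ interior (condLaw m κ d x).support, f d x y ≤ M) ∧
    ContinuousOn (f d x) (interior (condLaw m κ d x).support)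
  contDiff_condCdf : ∀ x ∈ (P.map X).support, ∀ y : ℝ,
    ContDiffOn ℝ 1 (fun d => condCdf m κ y d x) (interior (P.map D).support)
  measurable_structDeriv : ∀ d ∈ (P.map D).support, ∀ x ∈ (P.map X).support,
    Measurable (structDeriv m d x)
  expansion : ∀ d ∈ (P.map D).support, ∀ x ∈ (P.map X).support, ∀ ν : ℝ, 0 < ν →
    (fun δ : ℝ => (κ (d, x)).real {e | ν * δ ≤ |m (d + δ) x e - m d x e
      - δ * structDeriv m d x e|}) =o[𝓝[>] 0] (fun δ : ℝ => δ)
  joint_density : ∃ (C : ℝ) (g : ℝ → ℝ), 0 < C ∧ Integrable g ∧ Integrable (fun y' => y' * g y') ∧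
    ∀ d ∈ (P.map D).support, ∀ x ∈ (P.map X).support,
      HasDominatedDensity ((κ (d, x)).map fun e => (m d x e, structDeriv m d x e))
        (condLaw m κ d x).support C g

/-- Compactness of the outcome distributions: the support of `Y` is compact, and one compact set
carries both the laws of `Y^t` for small `t > 0` (so that the mean functional is applied to
distributions on a fixed compact set) and the conditional laws of `Y` given `(D, X)`. -/
structure CompactOutcomes (P : Measure Ω) (m : ℝ → (Fin k → ℝ) → E → ℝ) (π : ℝ → ℝ → ℝ)
    (D : Ω → ℝ) (X : Ω → Fin k → ℝ) (ε : Ω → E) (κ : Kernel (ℝ × (Fin k → ℝ)) E) : Prop where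
  compact_support : IsCompact (P.map (outcome m D X ε)).support
  common : ∃ K : Set ℝ, IsCompact K ∧
    (∀ᶠ t in 𝓝[>] (0 : ℝ), ∀ᵐ ω ∂P, cfOutcome m π D X ε t ω ∈ K) ∧
    ∀ d ∈ (P.map D).support, ∀ x ∈ (P.map X).support, ∀ᵐ e ∂(κ (d, x)), m d x e ∈ K

end MPE

end

/-! All three expressions equal the mean of `responseDeriv`. Since the outcomes share a bound `R`,
the event where the first-order expansion fails by `ν t` contributes only `o(t)` to the mean, so
means can be differentiated along the expansion (`tendsto_slope_integral_of_expansion`).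
Unconditionally this gives the policy effect. Conditionally on `(d, x)`, independence freezes the
law of `ε` while `d` moves, and the right derivative of `condMean` is the conditional mean of
`structDeriv`.

For a two-sided derivative, `condMean` is written as `R` minus the integral of `condCdf` over `[-R,
R]` and differentiated under the integral (`hasDerivAt_condMean`). The required uniform bound on the
derivative of `condCdf` comes from counting crossings: the distribution function at `y` changes only
if a path starting at `u` with slope `v` can reach `y`, so `|u - y| ≤ δ (|v| + 1)`, and domination
of the joint law by Lebesgue measure times a measure with a first moment makes this mass `O(δ)`.

Multiplying `beta` by the density should give minus that derivative, but the density may vanish on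
sets of positive measure. At almost every such `y` the set where the density is nonzero has Lebesgue
density zero, the crossing mass improves to `o(δ)`, and the derivative vanishes too
(`ae_deriv_condCdf_eq_zero`). Disintegrating over `(D, X)` then identifies the three means. -/

namespace MPE

/-! ### Differentiation of means along stochastic expansions -/

/-- If `U t = U₀ + t V + o(t)` in the sense of `P[|U t - U₀ - t V| ≥ ν t] = o(t)` and the variables
are uniformly bounded, then the mean of `U t` has right derivative `∫ V` at `t = 0`. -/
theorem tendsto_slope_integral_of_expansion {α : Type*} [MeasurableSpace α] {μ : Measure α}
    [IsProbabilityMeasure μ] {U : ℝ → α → ℝ} {U₀ V : α → ℝ} {R : ℝ}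
    (hU : ∀ᶠ t in 𝓝[>] (0 : ℝ), Measurable (U t)) (hU₀ : Measurable U₀) (hV : Measurable V)
    (hVi : Integrable V μ) (hUR : ∀ᶠ t in 𝓝[>] (0 : ℝ), ∀ᵐ a ∂μ, |U t a| ≤ R)
    (hU₀R : ∀ᵐ a ∂μ, |U₀ a| ≤ R)
    (hexp : ∀ ν : ℝ, 0 < ν → (fun t : ℝ => μ.real {a | ν * t ≤ |U t a - U₀ a - t * V a|})
      =o[𝓝[>] 0] (fun t : ℝ => t)) :
    Tendsto (fun t : ℝ => (∫ a, U t a ∂μ - ∫ a, U₀ a ∂μ) / t) (𝓝[>] 0) (𝓝 (∫ a, V a ∂μ)) := by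
  rw [Metric.tendsto_nhds]
  intro ϵ hϵ
  -- Off `A t` the error is at most `ν t`; on `A t` it is at most `2 R + t |V|`, whose integral is
  -- eventually below `ν t`. The total `2 ν t` stays below `ϵ t`.
  have hν : 0 < ϵ / 3 := by positivity
  set ν := ϵ / 3 with hνdef
  set A : ℝ → Set α := fun t => {a | ν * t ≤ |U t a - U₀ a - t * V a|} with hA
  have hlim : Tendsto (fun t => μ.real (A t) / t) (𝓝[>] 0) (𝓝 0) :=
    (hexp ν hν).tendsto_div_nhds_zero
  have hlim' : Tendsto (fun t => μ.real (A t)) (𝓝[>] 0) (𝓝 0) := by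
    refine (hexp ν hν).trans_tendsto ?_
    exact tendsto_id.mono_left nhdsWithin_le_nhds
  have hlimE : Tendsto (μ ∘ A) (𝓝[>] 0) (𝓝 0) := by
    refine (ENNReal.tendsto_toReal_iff (fun _ => measure_ne_top _ _) ENNReal.zero_ne_top).1 ?_
    simpa [measureReal_def] using hlim'
  -- Absolute continuity of the integral of `|V|`.
  have hint : Tendsto (fun t => ∫ a in A t, |V a| ∂μ) (𝓝[>] 0) (𝓝 0) :=
    hVi.abs.tendsto_setIntegral_nhds_zero hlimE
  have hsum : Tendsto (fun t => 2 * R * (μ.real (A t) / t) + ∫ a in A t, |V a| ∂μ)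
      (𝓝[>] 0) (𝓝 0) := by simpa using (hlim.const_mul (2 * R)).add hint
  filter_upwards [hU, hUR, self_mem_nhdsWithin, hsum.eventually_lt_const hν]
    with t hUt hUtR ht hlt
  have ht : 0 < t := ht
  have hUi : Integrable (U t) μ :=
    Integrable.of_bound hUt.aestronglyMeasurable R hUtR
  have hU₀i : Integrable U₀ μ := Integrable.of_bound hU₀.aestronglyMeasurable R hU₀R
  have hAm : MeasurableSet (A t) :=
    measurableSet_le measurable_const ((hUt.sub hU₀).sub (hV.const_mul t)).norm
  have hbd : |∫ a, (U t a - U₀ a - t * V a) ∂μ| ≤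
      ∫ a, (ν * t + (A t).indicator (fun a => 2 * R + t * |V a|) a) ∂μ := by
    refine (abs_integral_le_integral_abs).trans ?_
    refine integral_mono_ae ((hUi.sub hU₀i).sub (hVi.const_mul t)).abs ?_ ?_
    · exact (integrable_const _).add
        (((integrable_const _).add (hVi.abs.const_mul t)).indicator hAm)
    · filter_upwards [hUtR, hU₀R] with a h1 h2
      by_cases ha : a ∈ A t
      · rw [Set.indicator_of_mem ha]
        have h3 : |t * V a| = t * |V a| := by rw [abs_mul, abs_of_pos ht]
        have h4 := abs_sub (U t a - U₀ a) (t * V a)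
        have h5 := abs_sub (U t a) (U₀ a)
        have : 0 ≤ ν * t := by positivity
        show |U t a - U₀ a - t * V a| ≤ _
        linarith
      · rw [Set.indicator_of_notMem ha, add_zero]
        exact (not_le.1 ha).le
  have hbi : Integrable (fun a => 2 * R + t * |V a|) μ :=
    (integrable_const _).add (hVi.abs.const_mul t)
  have hdi : Integrable (fun a => U t a - U₀ a) μ := hUi.sub hU₀i
  rw [integral_add (integrable_const _) (hbi.indicator hAm), integral_indicator hAm, integral_add (integrable_const _) (hVi.abs.const_mul t).integrableOn,
    integral_sub hdi (hVi.const_mul t), integral_sub hUi hU₀i,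
    integral_const_mul t, integral_const_mul t] at hbd
  simp only [integral_const, smul_eq_mul, probReal_univ, one_mul, measureReal_restrict_apply_univ]
    at hbd
  have hEq : (∫ a, U t a ∂μ - ∫ a, U₀ a ∂μ) / t - ∫ a, V a ∂μ
      = (∫ a, U t a ∂μ - ∫ a, U₀ a ∂μ - t * ∫ a, V a ∂μ) / t := by field_simp
  rw [Real.dist_eq, hEq, abs_div, abs_of_pos ht, div_lt_iff₀ ht]
  have h6 : 2 * R * (μ.real (A t) / t) * t = μ.real (A t) * (2 * R) := by field_simp
  have h7 := mul_lt_mul_of_pos_right hlt ht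
  rw [add_mul, h6] at h7
  have h8 : ϵ * t = 3 * (ν * t) := by rw [hνdef]; ring
  have : 0 < ν * t := by positivity
  nlinarith

/-- The mean of a law on `[-R, R]` in terms of its distribution function. -/
theorem integral_id_eq_sub_integral_cdf {μ : Measure ℝ} [IsProbabilityMeasure μ] {R : ℝ}
    (hμ : ∀ᵐ y ∂μ, |y| ≤ R) :
    ∫ y, y ∂μ = R - ∫ y in Set.Icc (-R) R, cdf μ y := by
  have hR : 0 ≤ R := by
    obtain ⟨y, hy⟩ := hμ.exists
    exact (abs_nonneg y).trans hy
  have hi : Integrable (fun y : ℝ => y) μ := Integrable.of_bound (by fun_prop) R hμ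
  -- Layer cake for `R - y`, which takes values in `[0, 2R]`; its upper tails are values of the
  -- distribution function.
  have h1 := Integrable.integral_eq_integral_Ioc_meas_le (μ := μ) (f := fun y => R - y)
    (M := 2 * R) ((integrable_const R).sub hi)
    (by filter_upwards [hμ] with y hy; simpa using (abs_le.1 hy).2)
    (by filter_upwards [hμ] with y hy; linarith [(abs_le.1 hy).1])
  rw [integral_sub (integrable_const R) hi] at h1
  simp only [integral_const, probReal_univ, one_smul] at h1
  have h2 : ∀ t, μ.real {y | t ≤ R - y} = cdf μ (R - t) := fun t => by
    rw [cdf_eq_real]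
    congr 1
    ext y
    simp only [Set.mem_ofPred_eq, Set.mem_Iic]
    constructor <;> intro h <;> linarith
  simp only [h2] at h1
  rw [← intervalIntegral.integral_of_le (by linarith),
    intervalIntegral.integral_comp_sub_left (fun y => cdf μ y) R, sub_zero,
    show R - 2 * R = -R by ring, intervalIntegral.integral_of_le (by linarith),
    ← integral_Icc_eq_integral_Ioc] at h1
  linarith

/-! ### Dominated densities -/

/-- The measure on the second coordinate which dominates a density bounded by `C |g(y')|`. -/
noncomputable def domMeasure (C : ℝ) (g : ℝ → ℝ) : Measure ℝ :=
  volume.withDensity fun v => ENNReal.ofReal (C * |g v|)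

instance (C : ℝ) (g : ℝ → ℝ) : SFinite (domMeasure C g) := by
  unfold domMeasure; infer_instance

/-- The product form makes Tonelli available: for each slope, the mass of a set of levels is
controlled by its length. -/
theorem HasDominatedDensity.le_prod {ρ : Measure (ℝ × ℝ)} {S : Set ℝ} {C : ℝ} {g : ℝ → ℝ}
    (h : HasDominatedDensity ρ S C g) (hg : Integrable g) :
    ρ ≤ (volume : Measure ℝ).prod (domMeasure C g) := by
  obtain ⟨f, -, -, rfl, -, hf⟩ := h
  rw [domMeasure, prod_withDensity_right₀
    (hg.abs.const_mul C).aestronglyMeasurable.aemeasurable.ennreal_ofReal, Measure.volume_eq_prod]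
  exact withDensity_mono (Eventually.of_forall fun p => ENNReal.ofReal_le_ofReal (hf p.1 p.2))

/-- The weight `|v| + 1` is the half-width of a crossing region per unit of `δ`; its two terms use
the two integrability conditions on `g`. -/
theorem lintegral_domMeasure_ne_top {C : ℝ} {g : ℝ → ℝ} (hC : 0 < C) (hg : Integrable g)
    (hyg : Integrable fun y => y * g y) :
    ∫⁻ v, ENNReal.ofReal (|v| + 1) ∂(domMeasure C g) ≠ ⊤ := by
  rw [domMeasure, lintegral_withDensity_eq_lintegral_mul₀
    (hg.abs.const_mul C).aestronglyMeasurable.aemeasurable.ennreal_ofReal (by fun_prop)]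
  have hi : Integrable fun v => C * |g v| * (|v| + 1) := by
    refine ((hyg.abs.add hg.abs).const_mul C).congr (Eventually.of_forall fun v => ?_)
    simp only [Pi.add_apply, abs_mul]
    ring
  refine ne_of_eq_of_ne (lintegral_congr fun v => ?_) hi.lintegral_lt_top.ne
  rw [Pi.mul_apply, ← ENNReal.ofReal_mul (by positivity)]

/-- A law dominated by a product `volume ⊗ τ` and carried by a bounded strip has integrable second
coordinate if `τ` has a first moment. -/
theorem integrable_snd_of_le_prod {ρ : Measure (ℝ × ℝ)} {τ : Measure ℝ} [SFinite τ] {R : ℝ}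
    (hρ : ρ ≤ (volume : Measure ℝ).prod τ) (hR : ∀ᵐ p ∂ρ, |p.1| ≤ R)
    (hτ : ∫⁻ v, ENNReal.ofReal (|v| + 1) ∂τ ≠ ⊤) : Integrable (fun p : ℝ × ℝ => p.2) ρ := by
  refine ⟨by fun_prop, ?_⟩
  -- Lebesgue measure of the levels is infinite, so both measures are first cut down to the strip
  -- carrying `ρ`.
  have hK : MeasurableSet (Metric.closedBall (0 : ℝ) R ×ˢ (Set.univ : Set ℝ)) :=
    measurableSet_closedBall.prod MeasurableSet.univ
  have hres : ρ = ρ.restrict (Metric.closedBall (0 : ℝ) R ×ˢ Set.univ) := by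
    refine (Measure.restrict_eq_self_of_ae_mem ?_).symm
    filter_upwards [hR] with p hp
    simpa using hp
  rw [hasFiniteIntegral_iff_enorm, hres]
  calc ∫⁻ p, ‖p.2‖ₑ ∂(ρ.restrict (Metric.closedBall (0 : ℝ) R ×ˢ Set.univ))
      ≤ ∫⁻ p, 1 * ENNReal.ofReal (|p.2| + 1)
          ∂((volume.prod τ).restrict (Metric.closedBall (0 : ℝ) R ×ˢ Set.univ)) := by
        refine lintegral_mono' (Measure.restrict_mono le_rfl hρ) fun p => ?_
        rw [one_mul, Real.enorm_eq_ofReal_abs]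
        exact ENNReal.ofReal_le_ofReal (by linarith)
    _ = volume (Metric.closedBall (0 : ℝ) R) * ∫⁻ v, ENNReal.ofReal (|v| + 1) ∂τ := by
        rw [← Measure.prod_restrict, Measure.restrict_univ,
          lintegral_prod_mul (f := fun _ => 1) (g := fun v => ENNReal.ofReal (|v| + 1))
            (by fun_prop) (by fun_prop)]
        simp
    _ < ⊤ := ENNReal.mul_lt_top measure_closedBall_lt_top hτ.lt_top

/-! ### Mass of the crossing regions -/

/-- The region where `y` is crossed by a path through `u` with slope at most `|v| + 1` before
time `δ`. -/
def crossing (y δ : ℝ) : Set (ℝ × ℝ) := {p | |p.1 - y| ≤ δ * (|p.2| + 1)}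

theorem measurableSet_crossing (y δ : ℝ) : MeasurableSet (crossing y δ) :=
  measurableSet_le (by fun_prop) (by fun_prop)

theorem prod_crossing_inter {τ : Measure ℝ} [SFinite τ] {S : Set ℝ} (hS : MeasurableSet S)
    (y δ : ℝ) :
    (volume.prod τ) (crossing y δ ∩ S ×ˢ Set.univ)
      = ∫⁻ v, volume (S ∩ Metric.closedBall y (δ * (|v| + 1))) ∂τ := by
  rw [Measure.prod_apply_symm ((measurableSet_crossing y δ).inter (hS.prod MeasurableSet.univ))]
  refine lintegral_congr fun v => congrArg _ ?_
  ext u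
  simp [crossing, Real.dist_eq, and_comm]

theorem measure_crossing_le {ρ : Measure (ℝ × ℝ)} {τ : Measure ℝ} [SFinite τ]
    (hρ : ρ ≤ (volume : Measure ℝ).prod τ) {y δ : ℝ} (hδ : 0 < δ) :
    ρ (crossing y δ) ≤ ENNReal.ofReal (2 * δ) * ∫⁻ v, ENNReal.ofReal (|v| + 1) ∂τ := by
  refine (hρ _).trans ?_
  have := prod_crossing_inter (τ := τ) MeasurableSet.univ y δ
  rw [Set.univ_prod_univ, Set.inter_univ] at this
  rw [this, ← lintegral_const_mul _ (by fun_prop)]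
  refine lintegral_mono fun v => ?_
  rw [Set.univ_inter, Real.volume_closedBall, ← ENNReal.ofReal_mul (by positivity), mul_assoc]

/-- At almost every point `y` outside a set `S` that carries the first marginal of `ρ`, the mass of
the crossing regions is `o(δ)`. -/
theorem tendsto_measure_crossing_div {ρ : Measure (ℝ × ℝ)} {τ : Measure ℝ} [SFinite τ]
    (hρ : ρ ≤ (volume : Measure ℝ).prod τ) (hτ : ∫⁻ v, ENNReal.ofReal (|v| + 1) ∂τ ≠ ⊤)
    {S : Set ℝ} (hS : MeasurableSet S) (hρS : ∀ᵐ p ∂ρ, p.1 ∈ S) :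
    ∀ᵐ y, y ∉ S → Tendsto (fun δ => ρ (crossing y δ) / ENNReal.ofReal δ) (𝓝[>] 0) (𝓝 0) := by
  -- Lebesgue density theorem: `S` has density zero at almost every `y ∉ S`. For each fixed `v` this
  -- is used at radius `δ (|v| + 1)`, and dominated convergence with envelope `2 (|v| + 1)`
  -- integrates over `v`.
  filter_upwards [Besicovitch.ae_tendsto_measure_inter_div_of_measurableSet volume hS] with y hy hyS
  rw [Set.indicator_of_notMem hyS] at hy
  have hle : ∀ δ, ρ (crossing y δ) ≤
      ∫⁻ v, volume (S ∩ Metric.closedBall y (δ * (|v| + 1))) ∂τ := fun δ => by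
    rw [← prod_crossing_inter hS]
    refine le_trans (le_of_eq (measure_congr ?_)) (hρ _)
    filter_upwards [hρS] with p hp
    apply propext
    exact ⟨fun h => ⟨h, hp, trivial⟩, fun h => h.1⟩
  have hlim : Tendsto (fun δ => ∫⁻ v, volume (S ∩ Metric.closedBall y (δ * (|v| + 1))) /
      ENNReal.ofReal δ ∂τ) (𝓝[>] 0) (𝓝 (∫⁻ _, 0 ∂τ)) := by
    refine tendsto_lintegral_filter_of_dominated_convergence
      (fun v => 2 * ENNReal.ofReal (|v| + 1)) ?_ ?_ ?_ ?_
    · refine Eventually.of_forall fun δ => Measurable.div_const ?_ _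
      have := measurable_measure_prodMk_right (μ := (volume : Measure ℝ))
        ((measurableSet_crossing y δ).inter (hS.prod MeasurableSet.univ))
      refine (congrArg Measurable (funext fun v => congrArg _ ?_)).mp this
      ext u
      simp [crossing, Real.dist_eq, and_comm]
    · filter_upwards [self_mem_nhdsWithin] with δ hδ
      have hδ : 0 < δ := hδ
      refine Eventually.of_forall fun v => ?_
      refine ENNReal.div_le_of_le_mul ((measure_mono Set.inter_subset_right).trans ?_)
      rw [Real.volume_closedBall, ← ENNReal.ofReal_ofNat 2, ← ENNReal.ofReal_mul (by norm_num),
        ← ENNReal.ofReal_mul (by positivity)]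
      exact ENNReal.ofReal_le_ofReal (by linarith)
    · rw [lintegral_const_mul _ (by fun_prop)]
      exact ENNReal.mul_ne_top (by norm_num) hτ
    · refine Eventually.of_forall fun v => ?_
      have hc : 0 < |v| + 1 := by positivity
      have h1 : Tendsto (fun δ : ℝ => δ * (|v| + 1)) (𝓝[>] 0) (𝓝[>] 0) := by
        refine tendsto_nhdsWithin_iff.2 ⟨?_, ?_⟩
        · have : Tendsto (fun δ : ℝ => δ * (|v| + 1)) (𝓝 0) (𝓝 (0 * (|v| + 1))) :=
            (continuous_mul_const _).tendsto 0
          rw [zero_mul] at this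
          exact this.mono_left nhdsWithin_le_nhds
        · filter_upwards [self_mem_nhdsWithin] with δ hδ using mul_pos hδ hc
      have h2 := ENNReal.Tendsto.const_mul (a := ENNReal.ofReal (2 * (|v| + 1))) (hy.comp h1)
        (Or.inr ENNReal.ofReal_ne_top)
      rw [mul_zero] at h2
      refine h2.congr' ?_
      filter_upwards [self_mem_nhdsWithin] with δ hδ
      have hδ : 0 < δ := hδ
      simp only [Function.comp]
      rw [Real.volume_closedBall, show 2 * (δ * (|v| + 1)) = 2 * (|v| + 1) * δ by ring,
        ENNReal.ofReal_mul (p := 2 * (|v| + 1)) (by positivity), div_eq_mul_inv, div_eq_mul_inv,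
        ENNReal.mul_inv (Or.inr ENNReal.ofReal_ne_top) (Or.inl ENNReal.ofReal_ne_top),
        mul_left_comm, ← mul_assoc (ENNReal.ofReal (2 * (|v| + 1))),
        ENNReal.mul_inv_cancel (by simpa using hc) ENNReal.ofReal_ne_top, one_mul]
  rw [lintegral_zero] at hlim
  refine tendsto_of_tendsto_of_tendsto_of_le_of_le' tendsto_const_nhds hlim
    (Eventually.of_forall fun _ => zero_le) ?_
  filter_upwards [self_mem_nhdsWithin] with δ hδ
  have hδ : 0 < δ := hδ
  simp only [div_eq_mul_inv]
  rw [lintegral_mul_const' _ _ (ENNReal.inv_ne_top.2 (by simpa using hδ))]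
  gcongr
  exact hle δ

/-! ### Derivatives of distribution functions along stochastic expansions -/

/-- A distribution function changes by at most the probability that the expansion fails plus the
mass of the crossing region. -/
theorem abs_measureReal_sub_le_crossing {α : Type*} [MeasurableSpace α] {μ : Measure α}
    [IsProbabilityMeasure μ] {U₁ U₀ V : α → ℝ} (hU₀ : Measurable U₀) (hV : Measurable V)
    (y : ℝ) {δ : ℝ} (hδ : 0 < δ) :
    |μ.real {a | U₁ a ≤ y} - μ.real {a | U₀ a ≤ y}| ≤
      μ.real {a | 1 * δ ≤ |U₁ a - U₀ a - δ * V a|}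
        + (μ.map fun a => (U₀ a, V a)).real (crossing y δ) := by
  rw [map_measureReal_apply (hU₀.prodMk hV) (measurableSet_crossing y δ)]
  set B := {a | 1 * δ ≤ |U₁ a - U₀ a - δ * V a|} with hB
  set Cr := (fun a => (U₀ a, V a)) ⁻¹' crossing y δ with hCr
  -- Off `B` the displacement is below `δ (|V| + 1)`, the `1` being the tolerance `ν = 1`; off `Cr`
  -- this is less than the distance from `U₀` to `y`, so `y` is not passed.
  have key : ∀ a, a ∉ B → a ∉ Cr → (U₁ a ≤ y ↔ U₀ a ≤ y) := by
    intro a h1 h2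
    simp only [hB, hCr, crossing, Set.mem_ofPred_eq, Set.mem_preimage, not_le, one_mul] at h1 h2
    have h3 : |U₁ a - U₀ a| < δ * (|V a| + 1) := by
      have := abs_sub_abs_le_abs_sub (U₁ a - U₀ a) (δ * V a)
      rw [abs_mul, abs_of_pos hδ] at this
      linarith
    have h5 := abs_lt.1 (h3.trans h2)
    rcases abs_cases (U₀ a - y) with ⟨h, _⟩ | ⟨h, _⟩ <;> constructor <;> intro _ <;> linarith
  have h1 : μ.real {a | U₁ a ≤ y} ≤ μ.real {a | U₀ a ≤ y} + (μ.real B + μ.real Cr) := by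
    refine (measureReal_mono (s₂ := {a | U₀ a ≤ y} ∪ (B ∪ Cr)) fun a ha => ?_).trans
      ((measureReal_union_le _ _).trans (by gcongr; exact measureReal_union_le _ _))
    by_contra hn
    simp only [Set.mem_union, not_or] at hn
    exact hn.1 ((key a hn.2.1 hn.2.2).1 ha)
  have h2 : μ.real {a | U₀ a ≤ y} ≤ μ.real {a | U₁ a ≤ y} + (μ.real B + μ.real Cr) := by
    refine (measureReal_mono (s₂ := {a | U₁ a ≤ y} ∪ (B ∪ Cr)) fun a ha => ?_).trans
      ((measureReal_union_le _ _).trans (by gcongr; exact measureReal_union_le _ _))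
    by_contra hn
    simp only [Set.mem_union, not_or] at hn
    exact hn.1 ((key a hn.2.1 hn.2.2).2 ha)
  rw [abs_le]
  constructor <;> linarith

/-- If the increments of `F` to the right of `d` are at most `b δ + c δ` with `b = o(δ)` and
`c δ / δ ≤ u δ → L`, then `|F'(d)| ≤ L`. -/
theorem abs_deriv_le_of_increments {F : ℝ → ℝ} {d L : ℝ} (hF : DifferentiableAt ℝ F d)
    {b c u : ℝ → ℝ} (hb : b =o[𝓝[>] 0] fun δ => δ)
    (hle : ∀ᶠ δ in 𝓝[>] (0 : ℝ), |F (d + δ) - F d| ≤ b δ + c δ)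
    (hc : ∀ᶠ δ in 𝓝[>] (0 : ℝ), c δ ≤ u δ * δ) (hu : Tendsto u (𝓝[>] 0) (𝓝 L)) :
    |deriv F d| ≤ L := by
  have h1 := hF.hasDerivAt.tendsto_slope_zero_right.abs
  have h2 := hb.tendsto_div_nhds_zero.add hu
  rw [zero_add] at h2
  refine le_of_tendsto_of_tendsto h1 h2 ?_
  filter_upwards [hle, hc, self_mem_nhdsWithin] with δ h3 h4 hδ
  have hδ : 0 < δ := hδ
  rw [smul_eq_mul, abs_mul, abs_inv, abs_of_pos hδ, inv_mul_le_iff₀ hδ]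
  have : δ * (b δ / δ + u δ) = b δ + u δ * δ := by field_simp
  linarith

/-! ### Conditional laws -/

variable {Ω E : Type*} [MeasurableSpace Ω] [MeasurableSpace E] {k : ℕ}

theorem StructuralModel.measurable_section {P : Measure Ω} {m : ℝ → (Fin k → ℝ) → E → ℝ}
    {π : ℝ → ℝ → ℝ} {D : Ω → ℝ} {X : Ω → Fin k → ℝ} {ε : Ω → E} (hS : StructuralModel P m π D X ε)
    (d : ℝ) (x : Fin k → ℝ) : Measurable (m d x) :=
  hS.measurable_m.comp (by fun_prop : Measurable fun e : E => (d, x, e))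

theorem isProbabilityMeasure_condLaw {m : ℝ → (Fin k → ℝ) → E → ℝ} {d : ℝ} {x : Fin k → ℝ}
    (hm : Measurable (m d x)) (κ : Kernel (ℝ × (Fin k → ℝ)) E) [IsMarkovKernel κ] :
    IsProbabilityMeasure (condLaw m κ d x) :=
  Measure.isProbabilityMeasure_map hm.aemeasurable

theorem condCdf_eq_measureReal {m : ℝ → (Fin k → ℝ) → E → ℝ} {d : ℝ} {x : Fin k → ℝ}
    (hm : Measurable (m d x)) (κ : Kernel (ℝ × (Fin k → ℝ)) E) [IsMarkovKernel κ] (y : ℝ) :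
    condCdf m κ y d x = (κ (d, x)).real {e | m d x e ≤ y} := by
  have := isProbabilityMeasure_condLaw hm κ
  rw [condCdf, cdf_eq_real, condLaw, map_measureReal_apply hm measurableSet_Iic]
  rfl

theorem condMean_eq_integral {m : ℝ → (Fin k → ℝ) → E → ℝ} {d : ℝ} {x : Fin k → ℝ}
    (hm : Measurable (m d x)) (κ : Kernel (ℝ × (Fin k → ℝ)) E) :
    condMean m κ d x = ∫ e, m d x e ∂(κ (d, x)) :=
  integral_map hm.aemeasurable (by fun_prop)

theorem measurable_condCdf {m : ℝ → (Fin k → ℝ) → E → ℝ}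
    (hm : Measurable fun p : ℝ × (Fin k → ℝ) × E => m p.1 p.2.1 p.2.2)
    (κ : Kernel (ℝ × (Fin k → ℝ)) E) [IsMarkovKernel κ] :
    Measurable fun p : (ℝ × (Fin k → ℝ)) × ℝ => condCdf m κ p.2 p.1.1 p.1.2 := by
  have hs : MeasurableSet
      {q : ((ℝ × (Fin k → ℝ)) × ℝ) × E | m q.1.1.1 q.1.1.2 q.2 ≤ q.1.2} :=
    measurableSet_le (hm.comp (by fun_prop :
      Measurable fun q : ((ℝ × (Fin k → ℝ)) × ℝ) × E => (q.1.1.1, q.1.1.2, q.2))) (by fun_prop)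
  have h := Kernel.measurable_kernel_prodMk_left (κ := κ.comap
    (Prod.fst : (ℝ × (Fin k → ℝ)) × ℝ → ℝ × (Fin k → ℝ)) measurable_fst) hs
  refine (congrArg Measurable (funext fun p => ?_)).mp h.ennreal_toReal
  exact (condCdf_eq_measureReal
    (hm.comp (by fun_prop : Measurable fun e : E => (p.1.1, p.1.2, e))) κ p.2).symm

variable {P : Measure Ω} {m : ℝ → (Fin k → ℝ) → E → ℝ} {π : ℝ → ℝ → ℝ} {D : Ω → ℝ} {X : Ω → Fin k → ℝ}
  {ε : Ω → E} {κ : Kernel (ℝ × (Fin k → ℝ)) E}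
  {f : ℝ → (Fin k → ℝ) → ℝ → ℝ}

/-! ### Derivatives of conditional distribution functions and means -/

/-- Conditional independence enters here: near an interior `d`, a change of the policy variable
moves only the structural function, so increments in `d` can be computed under the single law `κ (d,
x)`. -/
theorem CondIndepOfPolicy.eventually_mem_and_eq (hCI : CondIndepOfPolicy P D X κ) {d : ℝ}
    (hd : d ∈ interior (P.map D).support) {x : Fin k → ℝ} (hx : x ∈ (P.map X).support) :
    ∀ᶠ δ in 𝓝[>] (0 : ℝ), d + δ ∈ (P.map D).support ∧ κ (d + δ, x) = κ (d, x) := by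
  obtain ⟨η, hη⟩ := hCI
  have h1 : Tendsto (fun δ : ℝ => d + δ) (𝓝[>] 0) (𝓝 d) := by
    have : Tendsto (fun δ : ℝ => d + δ) (𝓝 0) (𝓝 (d + 0)) := (continuous_const_add d).tendsto 0
    rw [add_zero] at this
    exact this.mono_left nhdsWithin_le_nhds
  filter_upwards [h1 (mem_interior_iff_mem_nhds.1 hd)] with δ hδ
  exact ⟨hδ, by rw [hη _ hδ _ hx, hη _ (interior_subset hd) _ hx]⟩

theorem CondRegularity.differentiableAt_condCdf (hC : CondRegularity P m D X κ f) {d : ℝ}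
    (hd : d ∈ interior (P.map D).support) {x : Fin k → ℝ} (hx : x ∈ (P.map X).support) (y : ℝ) :
    DifferentiableAt ℝ (fun s => condCdf m κ y s x) d :=
  ((hC.contDiff_condCdf x hx y).differentiableOn one_ne_zero).differentiableAt
    (isOpen_interior.mem_nhds hd)

theorem CompactOutcomes.exists_bound (hK : CompactOutcomes P m π D X ε κ) :
    ∃ R : ℝ, (∀ᶠ t in 𝓝[>] (0 : ℝ), ∀ᵐ ω ∂P, |cfOutcome m π D X ε t ω| ≤ R) ∧
      (∀ᵐ y ∂(P.map (outcome m D X ε)), |y| ≤ R) ∧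
      ∀ d ∈ (P.map D).support, ∀ x ∈ (P.map X).support, ∀ᵐ e ∂(κ (d, x)), |m d x e| ≤ R := by
  obtain ⟨K, hKc, h1, h2⟩ := hK.common
  obtain ⟨R, hR⟩ := (hKc.union hK.compact_support).isBounded.exists_norm_le
  refine ⟨R, ?_, ?_, fun d hd x hx => ?_⟩
  · filter_upwards [h1] with t ht
    filter_upwards [ht] with ω hω using hR _ (Or.inl hω)
  · filter_upwards [Measure.support_mem_ae] with y hy using hR _ (Or.inr hy)
  · filter_upwards [h2 d hd x hx] with e he using hR _ (Or.inl he)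

theorem integrable_structDeriv (hS : StructuralModel P m π D X ε)
    (hC : CondRegularity P m D X κ f) {d : ℝ} (hd : d ∈ (P.map D).support) {x : Fin k → ℝ}
    (hx : x ∈ (P.map X).support) {R : ℝ} (hR : ∀ᵐ e ∂(κ (d, x)), |m d x e| ≤ R) :
    Integrable (structDeriv m d x) (κ (d, x)) := by
  obtain ⟨C, g, hC0, hg, hyg, hdom⟩ := hC.joint_density
  have hp := (hS.measurable_section d x).prodMk (hC.measurable_structDeriv d hd x hx)
  have h := integrable_snd_of_le_prod ((hdom d hd x hx).le_prod hg) (R := R)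
    ((ae_map_iff hp.aemeasurable (measurableSet_le (by fun_prop) (by fun_prop))).2 hR)
    (lintegral_domMeasure_ne_top hC0 hg hyg)
  exact (integrable_map_measure (by fun_prop) hp.aemeasurable).1 h

section MarkovKernel

variable [IsMarkovKernel κ]

theorem eventually_abs_condCdf_sub_le (hS : StructuralModel P m π D X ε)
    (hCI : CondIndepOfPolicy P D X κ) (hC : CondRegularity P m D X κ f) {d : ℝ}
    (hd : d ∈ interior (P.map D).support) {x : Fin k → ℝ} (hx : x ∈ (P.map X).support) (y : ℝ) :
    ∀ᶠ δ in 𝓝[>] (0 : ℝ), |condCdf m κ y (d + δ) x - condCdf m κ y d x| ≤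
      (κ (d, x)).real {e | 1 * δ ≤ |m (d + δ) x e - m d x e - δ * structDeriv m d x e|}
        + (((κ (d, x)).map fun e => (m d x e, structDeriv m d x e)) (crossing y δ)).toReal := by
  filter_upwards [hCI.eventually_mem_and_eq hd hx, self_mem_nhdsWithin] with δ h hδ
  rw [condCdf_eq_measureReal (hS.measurable_section _ _),
    condCdf_eq_measureReal (hS.measurable_section _ _), h.2]
  exact abs_measureReal_sub_le_crossing (hS.measurable_section _ _)
    (hC.measurable_structDeriv d (interior_subset hd) x hx) y hδ

/-- The derivatives `∂_d F_{Y|D,X}(y|d, x)` are bounded uniformly in `(d, x, y)`. -/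
theorem exists_abs_deriv_condCdf_le (hS : StructuralModel P m π D X ε)
    (hCI : CondIndepOfPolicy P D X κ) (hC : CondRegularity P m D X κ f) :
    ∃ L : ℝ, ∀ d ∈ interior (P.map D).support, ∀ x ∈ (P.map X).support, ∀ y,
      |deriv (fun s => condCdf m κ y s x) d| ≤ L := by
  obtain ⟨C, g, hC0, hg, hyg, hdom⟩ := hC.joint_density
  have hτ := lintegral_domMeasure_ne_top hC0 hg hyg
  -- The constant of `measure_crossing_le`; it is uniform because `C` and `g` do not depend on `(d,
  -- x)`.
  refine ⟨2 * (∫⁻ v, ENNReal.ofReal (|v| + 1) ∂(domMeasure C g)).toReal, fun d hd x hx y => ?_⟩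
  refine abs_deriv_le_of_increments (hC.differentiableAt_condCdf hd hx y)
    (hC.expansion d (interior_subset hd) x hx 1 one_pos)
    (eventually_abs_condCdf_sub_le hS hCI hC hd hx y) ?_ tendsto_const_nhds
  filter_upwards [self_mem_nhdsWithin] with δ hδ
  have hδ : 0 < δ := hδ
  refine (ENNReal.toReal_mono (ENNReal.mul_ne_top ENNReal.ofReal_ne_top hτ)
    (measure_crossing_le ((hdom d (interior_subset hd) x hx).le_prod hg) hδ)).trans_eq ?_
  rw [ENNReal.toReal_mul, ENNReal.toReal_ofReal (by positivity)]
  ring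

/-- `∂_d F_{Y|D,X}(y|d, x)` vanishes at almost every `y` where the conditional density does. -/
theorem ae_deriv_condCdf_eq_zero (hS : StructuralModel P m π D X ε)
    (hCI : CondIndepOfPolicy P D X κ) (hC : CondRegularity P m D X κ f) {d : ℝ}
    (hd : d ∈ interior (P.map D).support) {x : Fin k → ℝ} (hx : x ∈ (P.map X).support) :
    ∀ᵐ y, f d x y = 0 → deriv (fun s => condCdf m κ y s x) d = 0 := by
  obtain ⟨C, g, hC0, hg, hyg, hdom⟩ := hC.joint_density
  have hf : Measurable (f d x) :=
    hC.measurable_f.comp (by fun_prop : Measurable fun y : ℝ => (d, x, y))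
  -- The carrier is `{f ≠ 0}` and not the support: positivity is known only in the interior of the
  -- support, whose boundary may have positive measure.
  have hs : MeasurableSet {y | f d x y ≠ 0} := hf (measurableSet_singleton 0).compl
  have hm := hS.measurable_section d x
  have hd' := interior_subset hd
  have hcar : ∀ᵐ p ∂((κ (d, x)).map fun e => (m d x e, structDeriv m d x e)),
      p.1 ∈ {y | f d x y ≠ 0} := by
    rw [ae_map_iff (hm.prodMk (hC.measurable_structDeriv d hd' x hx)).aemeasurable
      (measurable_fst hs)]
    have h : ∀ᵐ y ∂(condLaw m κ d x), f d x y ≠ 0 := by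
      rw [(hC.density d hd' x hx).1, ae_withDensity_iff hf.ennreal_ofReal]
      refine Eventually.of_forall fun y hy h0 => hy ?_
      rw [h0, ENNReal.ofReal_zero]
    exact ae_of_ae_map hm.aemeasurable h
  filter_upwards [tendsto_measure_crossing_div ((hdom d hd' x hx).le_prod hg)
    (lintegral_domMeasure_ne_top hC0 hg hyg) hs hcar] with y hy h0
  have hlim := (ENNReal.tendsto_toReal ENNReal.zero_ne_top).comp (hy fun h => h h0)
  refine abs_nonpos_iff.1 (abs_deriv_le_of_increments (hC.differentiableAt_condCdf hd hx y)
    (hC.expansion d hd' x hx 1 one_pos)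
    (eventually_abs_condCdf_sub_le hS hCI hC hd hx y) ?_ hlim)
  filter_upwards [self_mem_nhdsWithin] with δ hδ
  have hδ : 0 < δ := hδ
  simp only [Function.comp, ENNReal.toReal_div, ENNReal.toReal_ofReal hδ.le]
  rw [div_mul_cancel₀ _ hδ.ne']

theorem measurable_deriv_condCdf (hS : StructuralModel P m π D X ε)
    (hC : CondRegularity P m D X κ f) {d : ℝ}
    (hd : d ∈ interior (P.map D).support) {x : Fin k → ℝ} (hx : x ∈ (P.map X).support) :
    Measurable fun y => deriv (fun s => condCdf m κ y s x) d := by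
  refine measurable_of_tendsto_metrizable' (𝓝[>] (0 : ℝ))
    (f := fun δ y => δ⁻¹ • (condCdf m κ y (d + δ) x - condCdf m κ y d x)) (fun δ => ?_)
    (tendsto_pi_nhds.2 fun y =>
      (hC.differentiableAt_condCdf hd hx y).hasDerivAt.tendsto_slope_zero_right)
  have h : ∀ s, Measurable fun y => condCdf m κ y s x := fun s =>
    (measurable_condCdf hS.measurable_m κ).comp
      (by fun_prop : Measurable fun y : ℝ => (((s, x), y) : (ℝ × (Fin k → ℝ)) × ℝ))
  exact ((h (d + δ)).sub (h d)).const_smul δ⁻¹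

/-- The conditional mean is differentiable in `d`, with derivative the conditional mean of the
structural derivative. -/
theorem hasDerivAt_condMean (hS : StructuralModel P m π D X ε)
    (hCI : CondIndepOfPolicy P D X κ) (hC : CondRegularity P m D X κ f) {R : ℝ}
    (hR : ∀ d ∈ (P.map D).support, ∀ x ∈ (P.map X).support, ∀ᵐ e ∂(κ (d, x)), |m d x e| ≤ R)
    {d : ℝ} (hd : d ∈ interior (P.map D).support) {x : Fin k → ℝ} (hx : x ∈ (P.map X).support) :
    IntegrableOn (fun y => deriv (fun s => condCdf m κ y s x) d) (Set.Icc (-R) R) ∧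
    ∫ y in Set.Icc (-R) R, deriv (fun s => condCdf m κ y s x) d
      = -∫ e, structDeriv m d x e ∂(κ (d, x)) ∧
    HasDerivAt (fun s => condMean m κ s x) (∫ e, structDeriv m d x e ∂(κ (d, x))) d := by
  obtain ⟨L, hL⟩ := exists_abs_deriv_condCdf_le hS hCI hC
  have hI : interior (P.map D).support ∈ 𝓝 d := isOpen_interior.mem_nhds hd
  have hmeas : ∀ s, Measurable fun y => condCdf m κ y s x := fun s =>
    (measurable_condCdf hS.measurable_m κ).comp
      (by fun_prop : Measurable fun y : ℝ => (((s, x), y) : (ℝ × (Fin k → ℝ)) × ℝ))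
  have hle : ∀ s y, ‖condCdf m κ y s x‖ ≤ 1 := fun s y => by
    rw [condCdf, Real.norm_of_nonneg (cdf_nonneg _ _)]
    exact cdf_le_one _ _
  obtain ⟨hi, hderiv⟩ := hasDerivAt_integral_of_dominated_loc_of_deriv_le
    (μ := volume.restrict (Set.Icc (-R) R)) (F := fun s y => condCdf m κ y s x)
    (F' := fun s y => deriv (fun s => condCdf m κ y s x) s) (bound := fun _ => L) hI
    (Eventually.of_forall fun s => (hmeas s).aestronglyMeasurable)
    (Integrable.of_bound (hmeas d).aestronglyMeasurable 1 (Eventually.of_forall (hle d)))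
    (measurable_deriv_condCdf hS hC hd hx).aestronglyMeasurable
    (Eventually.of_forall fun y s hs => hL s hs x hx y) (integrable_const L)
    (Eventually.of_forall fun y s hs => (hC.differentiableAt_condCdf hs hx y).hasDerivAt)
  have hmean : (fun s => condMean m κ s x) =ᶠ[𝓝 d]
      fun s => R - ∫ y in Set.Icc (-R) R, condCdf m κ y s x := by
    filter_upwards [hI] with s hs
    have := isProbabilityMeasure_condLaw (hS.measurable_section s x) κ
    exact integral_id_eq_sub_integral_cdf
      ((ae_map_iff (hS.measurable_section s x).aemeasurable
        (measurableSet_le (by fun_prop) (by fun_prop))).2 (hR s (interior_subset hs) x hx))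
  have hD := (hderiv.const_sub R).congr_of_eventuallyEq hmean
  -- Dominated differentiation has given existence of the derivative; the right-hand slope computed
  -- from the expansion now gives its value.
  have hright := tendsto_slope_integral_of_expansion (μ := κ (d, x))
    (U := fun δ e => m (d + δ) x e) (U₀ := m d x) (V := structDeriv m d x) (R := R)
    (Eventually.of_forall fun δ => hS.measurable_section _ x) (hS.measurable_section d x)
    (hC.measurable_structDeriv d (interior_subset hd) x hx)
    (integrable_structDeriv hS hC (interior_subset hd) hx (hR d (interior_subset hd) x hx))
    (by filter_upwards [hCI.eventually_mem_and_eq hd hx] with δ h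
        rw [← h.2]
        exact hR _ h.1 x hx)
    (hR d (interior_subset hd) x hx) (hC.expansion d (interior_subset hd) x hx)
  have heq := tendsto_nhds_unique (hD.tendsto_slope_zero_right.congr' (by
    filter_upwards [hCI.eventually_mem_and_eq hd hx] with δ h
    rw [condMean_eq_integral (hS.measurable_section _ x),
      condMean_eq_integral (hS.measurable_section _ x), h.2, smul_eq_mul, inv_mul_eq_div])) hright
  exact ⟨hi, by rw [← heq, neg_neg], heq ▸ hD⟩

/-- The conditional mean of `β` is the conditional mean of the structural derivative. -/
theorem integrable_and_integral_beta (hS : StructuralModel P m π D X ε)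
    (hCI : CondIndepOfPolicy P D X κ) (hC : CondRegularity P m D X κ f) {R L : ℝ}
    (hR : ∀ d ∈ (P.map D).support, ∀ x ∈ (P.map X).support, ∀ᵐ e ∂(κ (d, x)), |m d x e| ≤ R)
    (hL : ∀ d ∈ interior (P.map D).support, ∀ x ∈ (P.map X).support, ∀ y,
      |deriv (fun s => condCdf m κ y s x) d| ≤ L)
    {d : ℝ} (hd : d ∈ interior (P.map D).support) {x : Fin k → ℝ} (hx : x ∈ (P.map X).support) :
    Integrable (fun e => beta m κ f d x (m d x e)) (κ (d, x)) ∧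
    ∫ e, beta m κ f d x (m d x e) ∂(κ (d, x)) = ∫ e, structDeriv m d x e ∂(κ (d, x)) ∧
    ∫ e, ‖beta m κ f d x (m d x e)‖ ∂(κ (d, x)) ≤ L * volume.real (Set.Icc (-R) R) := by
  obtain ⟨hi, hint, -⟩ := hasDerivAt_condMean hS hCI hC hR hd hx
  have hd' := interior_subset hd
  have hm := hS.measurable_section d x
  have hf : Measurable (f d x) :=
    hC.measurable_f.comp (by fun_prop : Measurable fun y : ℝ => (d, x, y))
  set G := fun y => deriv (fun s => condCdf m κ y s x) d with hG
  have hβ : Measurable (beta m κ f d x) := ((measurable_deriv_condCdf hS hC hd hx).div hf).neg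
  have hzero : ∀ᵐ y, f d x y = 0 → G y = 0 := ae_deriv_condCdf_eq_zero hS hCI hC hd hx
  -- The law lives on `[-R, R]`, so almost everywhere outside it the density is zero, and hence so
  -- is `G`.
  have hout : ∀ᵐ y, y ∉ Set.Icc (-R) R → G y = 0 := by
    have h : ∀ᵐ y ∂(condLaw m κ d x), |y| ≤ R :=
      (ae_map_iff hm.aemeasurable (measurableSet_le (by fun_prop) (by fun_prop))).2
        (hR d hd' x hx)
    rw [(hC.density d hd' x hx).1, ae_withDensity_iff hf.ennreal_ofReal] at h
    filter_upwards [h, hzero] with y h1 h2 hy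
    refine h2 (by_contra fun h0 => hy (abs_le.1 (h1 ?_)))
    simpa using (hC.nonneg_f d x y).lt_of_ne' h0
  have hGi : Integrable G :=
    IntegrableOn.integrable_of_ae_notMem_eq_zero hi hout
  -- Where the density vanishes the left side is `0` whatever `beta` is, so the identity there is
  -- exactly `hzero`.
  have hfβ : (fun y => (ENNReal.ofReal (f d x y)).toReal • beta m κ f d x y) =ᵐ[volume]
      fun y => -G y := by
    filter_upwards [hzero] with y hy
    rw [ENNReal.toReal_ofReal (hC.nonneg_f d x y), smul_eq_mul, beta]
    by_cases h0 : f d x y = 0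
    · rw [h0, hy h0, zero_mul, neg_zero]
    · rw [mul_neg, mul_div_cancel₀ _ h0]
  have hlt : ∀ᵐ y, ENNReal.ofReal (f d x y) < ⊤ :=
    Eventually.of_forall fun _ => ENNReal.ofReal_lt_top
  have hβi : Integrable (beta m κ f d x) (condLaw m κ d x) := by
    rw [(hC.density d hd' x hx).1,
      integrable_withDensity_iff_integrable_smul' hf.ennreal_ofReal hlt]
    exact hGi.neg.congr hfβ.symm
  refine ⟨(integrable_map_measure hβ.aestronglyMeasurable hm.aemeasurable).1 hβi, ?_, ?_⟩
  · rw [← integral_map (f := beta m κ f d x) hm.aemeasurable hβ.aestronglyMeasurable]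
    change ∫ y, beta m κ f d x y ∂(condLaw m κ d x) = _
    rw [(hC.density d hd' x hx).1, integral_withDensity_eq_integral_toReal_smul
      hf.ennreal_ofReal hlt, integral_congr_ae hfβ, integral_neg,
      ← setIntegral_eq_integral_of_ae_compl_eq_zero hout, hint, neg_neg]
  · rw [← integral_map (f := fun y => ‖beta m κ f d x y‖) hm.aemeasurable
      hβ.norm.aestronglyMeasurable]
    change ∫ y, ‖beta m κ f d x y‖ ∂(condLaw m κ d x) ≤ _
    rw [(hC.density d hd' x hx).1, integral_withDensity_eq_integral_toReal_smul
      hf.ennreal_ofReal hlt]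
    have hn : (fun y => (ENNReal.ofReal (f d x y)).toReal • ‖beta m κ f d x y‖) =ᵐ[volume]
        fun y => ‖G y‖ := by
      filter_upwards [hfβ] with y hy
      rw [← norm_neg (G y), ← hy, norm_smul, smul_eq_mul, Real.norm_of_nonneg ENNReal.toReal_nonneg]
    rw [integral_congr_ae hn, ← setIntegral_eq_integral_of_ae_compl_eq_zero (s := Set.Icc (-R) R)
      (by filter_upwards [hout] with y hy h; rw [hy h, norm_zero])]
    refine (Real.le_norm_self _).trans (norm_setIntegral_le_of_norm_le_const
      measure_Icc_lt_top fun y _ => ?_)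
    rw [norm_norm]
    exact hL d hd x hx y

end MarkovKernel

/-! ### The average marginal policy effect -/

theorem StructuralModel.measurable_cfOutcome (hS : StructuralModel P m π D X ε) {t : ℝ}
    (ht : t ∈ Set.Icc (0 : ℝ) 1) : Measurable (cfOutcome m π D X ε t) :=
  hS.measurable_m.comp (((hS.measurable_π t ht).comp hS.measurable_D).prodMk
    (hS.measurable_X.prodMk hS.measurable_ε))

theorem StructuralModel.measurable_outcome (hS : StructuralModel P m π D X ε) :
    Measurable (outcome m D X ε) :=
  hS.measurable_m.comp (hS.measurable_D.prodMk (hS.measurable_X.prodMk hS.measurable_ε))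

theorem meanFunctional_cdfOf [IsProbabilityMeasure P] {Z : Ω → ℝ} (hZ : Measurable Z) :
    meanFunctional (cdfOf P Z) = ∫ ω, Z ω ∂P := by
  have : IsProbabilityMeasure (P.map Z) := Measure.isProbabilityMeasure_map hZ.aemeasurable
  rw [meanFunctional, cdfOf, measure_cdf, integral_map hZ.aemeasurable (by fun_prop)]

theorem measurable_responseDeriv_comp (hS : StructuralModel P m π D X ε)
    (hR : Regularity P m π D X ε) :
    Measurable fun ω => responseDeriv m π (D ω) (X ω) (ε ω) :=
  hR.measurable_response.comp (hS.measurable_D.prodMk (hS.measurable_X.prodMk hS.measurable_ε))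

theorem integrable_responseDeriv (hS : StructuralModel P m π D X ε) (hR : Regularity P m π D X ε)
    {R : ℝ} (hY : ∀ᵐ y ∂(P.map (outcome m D X ε)), |y| ≤ R) :
    Integrable (fun ω => responseDeriv m π (D ω) (X ω) (ε ω)) P := by
  obtain ⟨C, g, hC0, hg, hyg, hdom⟩ := hR.joint_density
  have hp := hS.measurable_outcome.prodMk (measurable_responseDeriv_comp hS hR)
  have h := integrable_snd_of_le_prod (hdom.le_prod hg) (R := R)
    ((ae_map_iff hp.aemeasurable (measurableSet_le (by fun_prop) (by fun_prop))).2
      (ae_of_ae_map hS.measurable_outcome.aemeasurable hY))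
    (lintegral_domMeasure_ne_top hC0 hg hyg)
  exact (integrable_map_measure (by fun_prop) hp.aemeasurable).1 h

/-- The average marginal policy effect is the mean of the response derivative. -/
theorem isMarginalPolicyEffect_integral_responseDeriv [IsProbabilityMeasure P]
    (hS : StructuralModel P m π D X ε) (hR : Regularity P m π D X ε) {R : ℝ}
    (hYt : ∀ᶠ t in 𝓝[>] (0 : ℝ), ∀ᵐ ω ∂P, |cfOutcome m π D X ε t ω| ≤ R)
    (hY : ∀ᵐ y ∂(P.map (outcome m D X ε)), |y| ≤ R) :
    IsMarginalPolicyEffect P meanFunctional (outcome m D X ε) (cfOutcome m π D X ε)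
      (∫ ω, responseDeriv m π (D ω) (X ω) (ε ω) ∂P) := by
  have hmem : ∀ᶠ t in 𝓝[>] (0 : ℝ), Measurable (cfOutcome m π D X ε t) := by
    filter_upwards [Ioc_mem_nhdsGT one_pos] with t ht
    exact hS.measurable_cfOutcome ⟨ht.1.le, ht.2⟩
  refine (tendsto_slope_integral_of_expansion hmem hS.measurable_outcome
    (measurable_responseDeriv_comp hS hR) (integrable_responseDeriv hS hR hY) hYt
    (ae_of_ae_map hS.measurable_outcome.aemeasurable hY) hR.expansion).congr' ?_
  filter_upwards [hmem] with t ht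
  rw [meanFunctional_cdfOf ht, meanFunctional_cdfOf hS.measurable_outcome]

/-! ### Supports and measurability for the disintegration -/

theorem measurableSet_mem_support (P : Measure Ω) (D : Ω → ℝ) (X : Ω → Fin k → ℝ) :
    MeasurableSet {p : ℝ × (Fin k → ℝ) |
      p.1 ∈ interior (P.map D).support ∧ p.2 ∈ (P.map X).support} :=
  (isOpen_interior.measurableSet.preimage measurable_fst).inter
    (Measure.isClosed_support.measurableSet.preimage measurable_snd)

theorem StructuralModel.ae_mem_support (hS : StructuralModel P m π D X ε) :
    ∀ᵐ p ∂(P.map fun ω => (D ω, X ω)),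
      p.1 ∈ interior (P.map D).support ∧ p.2 ∈ (P.map X).support := by
  rw [ae_map_iff (hS.measurable_D.prodMk hS.measurable_X).aemeasurable
    (measurableSet_mem_support P D X)]
  filter_upwards [hS.interior_D, ae_of_ae_map hS.measurable_X.aemeasurable
    (Measure.support_mem_ae (μ := P.map X))] with ω h1 h2 using ⟨h1, h2⟩

/-- On the support, which has full measure, `policyDeriv` is the limit of difference quotients along
`1 / (n + 1)`, times in `(0, 1]` at which the policy is measurable. -/
theorem StructuralModel.aestronglyMeasurable_policyDeriv (hS : StructuralModel P m π D X ε) :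
    AEStronglyMeasurable (policyDeriv π) (P.map D) := by
  set T : ℕ → ℝ := fun n => 1 / ((n : ℝ) + 1) with hT
  have hpos : ∀ n, 0 < T n := fun n => Nat.one_div_pos_of_nat
  have hone : ∀ n, T n ≤ 1 := fun n => by
    rw [hT]
    exact div_le_one_of_le₀ (by linarith [(Nat.cast_nonneg n : (0 : ℝ) ≤ n)]) (by positivity)
  refine aestronglyMeasurable_of_tendsto_ae atTop
    (f := fun n d => slope (fun t => π t d) 0 (T n)) (fun n => ?_) ?_
  · exact (((hS.measurable_π _ ⟨(hpos n).le, hone n⟩).sub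
      (hS.measurable_π 0 ⟨le_rfl, zero_le_one⟩)).const_smul (T n - 0)⁻¹).aestronglyMeasurable
  · filter_upwards [Measure.support_mem_ae (μ := P.map D)] with d hd
    have h := ((hS.differentiable_π d hd).self_of_nhdsWithin
      ⟨le_rfl, zero_le_one⟩).hasDerivWithinAt
    refine (hasDerivWithinAt_iff_tendsto_slope.1 h).comp (tendsto_nhdsWithin_iff.2
      ⟨tendsto_one_div_add_atTop_nhds_zero_nat, Eventually.of_forall fun n => ?_⟩)
    exact ⟨⟨(hpos n).le, hone n⟩, (hpos n).ne'⟩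

/-- Differentiability of `condCdf` in `d` is known only on the supports, so the right difference
quotients converge almost everywhere; this gives measurability up to null sets. -/
theorem aestronglyMeasurable_beta [IsProbabilityMeasure P] [IsMarkovKernel κ]
    (hS : StructuralModel P m π D X ε) (hC : CondRegularity P m D X κ f) :
    AEStronglyMeasurable (fun q : (ℝ × (Fin k → ℝ)) × E => beta m κ f q.1.1 q.1.2
      (m q.1.1 q.1.2 q.2)) ((P.map fun ω => (D ω, X ω)) ⊗ₘ κ) := by
  have hprob : IsProbabilityMeasure (P.map fun ω => (D ω, X ω)) :=
    Measure.isProbabilityMeasure_map (hS.measurable_D.prodMk hS.measurable_X).aemeasurable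
  have hm : Measurable fun q : (ℝ × (Fin k → ℝ)) × E => m q.1.1 q.1.2 q.2 :=
    hS.measurable_m.comp
      (by fun_prop : Measurable fun q : (ℝ × (Fin k → ℝ)) × E => (q.1.1, q.1.2, q.2))
  have hF : ∀ δ : ℝ, Measurable fun q : (ℝ × (Fin k → ℝ)) × E =>
      condCdf m κ (m q.1.1 q.1.2 q.2) (q.1.1 + δ) q.1.2 := fun δ =>
    (measurable_condCdf hS.measurable_m κ).comp
      ((by fun_prop : Measurable fun q : (ℝ × (Fin k → ℝ)) × E => (q.1.1 + δ, q.1.2)).prodMk hm)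
  have hf : Measurable fun q : (ℝ × (Fin k → ℝ)) × E => f q.1.1 q.1.2 (m q.1.1 q.1.2 q.2) :=
    hC.measurable_f.comp ((measurable_fst.comp measurable_fst).prodMk
      ((measurable_snd.comp measurable_fst).prodMk hm))
  refine ((aestronglyMeasurable_of_tendsto_ae (𝓝[>] (0 : ℝ))
    (f := fun δ (q : (ℝ × (Fin k → ℝ)) × E) => δ⁻¹ •
      (condCdf m κ (m q.1.1 q.1.2 q.2) (q.1.1 + δ) q.1.2
        - condCdf m κ (m q.1.1 q.1.2 q.2) q.1.1 q.1.2)) (fun δ => ?_) ?_).aemeasurable.div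
      hf.aemeasurable).neg.aestronglyMeasurable
  · have h0 := hF 0
    simp only [add_zero] at h0
    exact (((hF δ).sub h0).const_smul δ⁻¹).aestronglyMeasurable
  · filter_upwards [Measure.ae_compProd_of_ae_fst κ (measurableSet_mem_support P D X)
      hS.ae_mem_support] with q hq
    exact (hC.differentiableAt_condCdf hq.1 hq.2 _).hasDerivAt.tendsto_slope_zero_right

end MPE

/-! ### Identification of the average effect -/

open MPE

theorem corollaryS {Ω E : Type*} [MeasurableSpace Ω] [MeasurableSpace E] {k : ℕ}
    (P : Measure Ω) [IsProbabilityMeasure P]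
    (m : ℝ → (Fin k → ℝ) → E → ℝ) (π : ℝ → ℝ → ℝ)
    (D : Ω → ℝ) (X : Ω → Fin k → ℝ) (ε : Ω → E)
    (hS : MPE.StructuralModel P m π D X ε)
    (hR : MPE.Regularity P m π D X ε)
    (κ : Kernel (ℝ × (Fin k → ℝ)) E) [IsMarkovKernel κ]
    (hκ : MPE.IsCondDistribOf P D X ε κ)
    (hCI : MPE.CondIndepOfPolicy P D X κ)
    (f : ℝ → (Fin k → ℝ) → ℝ → ℝ)
    (hC : MPE.CondRegularity P m D X κ f)
    (hK : MPE.CompactOutcomes P m π D X ε κ) :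
    -- the two right-hand sides are well defined
    Integrable (fun ω => MPE.policyDeriv π (D ω) *
      MPE.beta m κ f (D ω) (X ω) (MPE.outcome m D X ε ω)) P ∧
    (∀ᵐ ω ∂P, DifferentiableAt ℝ (fun d => MPE.condMean m κ d (X ω)) (D ω)) ∧
    Integrable (fun ω => MPE.policyDeriv π (D ω) *
      deriv (fun d => MPE.condMean m κ d (X ω)) (D ω)) P ∧
    -- the average marginal policy effect exists and is given by either of them
    MPE.IsMarginalPolicyEffect P MPE.meanFunctional (MPE.outcome m D X ε)
      (MPE.cfOutcome m π D X ε)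
      (∫ ω, MPE.policyDeriv π (D ω) *
        MPE.beta m κ f (D ω) (X ω) (MPE.outcome m D X ε ω) ∂P) ∧
    MPE.IsMarginalPolicyEffect P MPE.meanFunctional (MPE.outcome m D X ε)
      (MPE.cfOutcome m π D X ε)
      (∫ ω, MPE.policyDeriv π (D ω) *
        deriv (fun d => MPE.condMean m κ d (X ω)) (D ω) ∂P) := by
  obtain ⟨R, hYt, hY, hcond⟩ := hK.exists_bound
  obtain ⟨L, hL⟩ := exists_abs_deriv_condCdf_le hS hCI hC
  obtain ⟨B, hB⟩ := hS.bounded_policyDeriv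
  have hDX : Measurable fun ω => (D ω, X ω) := hS.measurable_D.prodMk hS.measurable_X
  have hDXε : Measurable fun ω => ((D ω, X ω), ε ω) := hDX.prodMk hS.measurable_ε
  have hprob : IsProbabilityMeasure (P.map fun ω => (D ω, X ω)) :=
    Measure.isProbabilityMeasure_map hDX.aemeasurable
  have hκ' : P.map (fun ω => ((D ω, X ω), ε ω)) = (P.map fun ω => (D ω, X ω)) ⊗ₘ κ := hκ
  set Q := P.map fun ω => (D ω, X ω) with hQ
  have hsupp := hS.ae_mem_support
  have hr : Measurable fun q : (ℝ × (Fin k → ℝ)) × E => responseDeriv m π q.1.1 q.1.2 q.2 :=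
    hR.measurable_response.comp
      (by fun_prop : Measurable fun q : (ℝ × (Fin k → ℝ)) × E => (q.1.1, q.1.2, q.2))
  have hri : Integrable (fun q : (ℝ × (Fin k → ℝ)) × E => responseDeriv m π q.1.1 q.1.2 q.2)
      (Q ⊗ₘ κ) := by
    rw [← hκ', integrable_map_measure hr.aestronglyMeasurable hDXε.aemeasurable]
    exact integrable_responseDeriv hS hR hY
  have hrint : ∫ ω, responseDeriv m π (D ω) (X ω) (ε ω) ∂P
      = ∫ p, ∫ e, responseDeriv m π p.1 p.2 e ∂(κ p) ∂Q := by
    rw [← Measure.integral_compProd hri, ← hκ',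
      integral_map hDXε.aemeasurable hr.aestronglyMeasurable]
  have hDmap : Q.map Prod.fst = P.map D := by
    rw [hQ, Measure.map_map measurable_fst hDX]
    rfl
  have hπ : AEStronglyMeasurable (fun p : ℝ × (Fin k → ℝ) => policyDeriv π p.1) Q := by
    have h := hS.aestronglyMeasurable_policyDeriv
    rw [← hDmap] at h
    exact h.comp_measurable measurable_fst
  have hπ' : AEStronglyMeasurable (fun q : (ℝ × (Fin k → ℝ)) × E => policyDeriv π q.1.1)
      (Q ⊗ₘ κ) := by
    rw [← Measure.fst_compProd Q κ] at hπ
    exact hπ.comp_measurable measurable_fst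
  have hβm := aestronglyMeasurable_beta (P := P) hS hC
  have hβi : Integrable (fun q : (ℝ × (Fin k → ℝ)) × E => beta m κ f q.1.1 q.1.2
      (m q.1.1 q.1.2 q.2)) (Q ⊗ₘ κ) := by
    refine (Measure.integrable_compProd_iff hβm).2 ⟨?_, ?_⟩
    · filter_upwards [hsupp] with p hp
      exact (integrable_and_integral_beta hS hCI hC hcond hL hp.1 hp.2).1
    -- The inner `L¹` norms are bounded uniformly in `(d, x)`, hence integrable over the probability
    -- measure `Q`. The kernels over `Unit` are those underlying `Q ⊗ₘ κ`.
    · refine Integrable.of_bound (AEStronglyMeasurable.integral_kernel_compProd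
        (κ := Kernel.const Unit Q) (η := Kernel.prodMkLeft Unit κ) (a := ()) hβm.norm)
        (L * volume.real (Set.Icc (-R) R)) ?_
      filter_upwards [hsupp] with p hp
      rw [Real.norm_of_nonneg (integral_nonneg fun _ => norm_nonneg _)]
      exact (integrable_and_integral_beta hS hCI hC hcond hL hp.1 hp.2).2.2
  have hπβ : Integrable (fun q : (ℝ × (Fin k → ℝ)) × E => policyDeriv π q.1.1 *
      beta m κ f q.1.1 q.1.2 (m q.1.1 q.1.2 q.2)) (Q ⊗ₘ κ) := by
    refine hβi.bdd_mul (c := B) hπ' ?_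
    filter_upwards [Measure.ae_compProd_of_ae_fst κ (measurableSet_mem_support P D X) hsupp]
      with q hq using hB _ (interior_subset hq.1)
  -- Given `(d, x)`, the policy derivative is a constant factor; both remaining identities reduce to
  -- the conditional mean of `structDeriv`.
  have hinner : ∀ᵐ p ∂Q, ∫ e, responseDeriv m π p.1 p.2 e ∂(κ p)
      = policyDeriv π p.1 * ∫ e, structDeriv m p.1 p.2 e ∂(κ p) :=
    Eventually.of_forall fun p => integral_const_mul _ _
  have hβint : ∫ ω, policyDeriv π (D ω) * beta m κ f (D ω) (X ω) (outcome m D X ε ω) ∂P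
      = ∫ ω, responseDeriv m π (D ω) (X ω) (ε ω) ∂P := by
    have h := hπβ.aestronglyMeasurable
    rw [← hκ'] at h
    refine (integral_map hDXε.aemeasurable h).symm.trans ?_
    rw [hrint, hκ', Measure.integral_compProd hπβ]
    refine integral_congr_ae ?_
    filter_upwards [hsupp, hinner] with p hp hp'
    rw [hp', integral_const_mul]
    exact congrArg _ (integrable_and_integral_beta hS hCI hC hcond hL hp.1 hp.2).2.1
  have hmean : (fun p : ℝ × (Fin k → ℝ) => policyDeriv π p.1 *
      deriv (fun d => condMean m κ d p.2) p.1) =ᵐ[Q]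
      fun p => ∫ e, responseDeriv m π p.1 p.2 e ∂(κ p) := by
    filter_upwards [hsupp, hinner] with p hp hp'
    rw [hp', (hasDerivAt_condMean hS hCI hC hcond hp.1 hp.2).2.2.deriv]
  have hmi : Integrable (fun p : ℝ × (Fin k → ℝ) => policyDeriv π p.1 *
      deriv (fun d => condMean m κ d p.2) p.1) Q :=
    (Integrable.integral_compProd (κ := Kernel.const Unit Q) (η := Kernel.prodMkLeft Unit κ)
      (a := ()) hri).congr hmean.symm
  have hmint : ∫ ω, policyDeriv π (D ω) * deriv (fun d => condMean m κ d (X ω)) (D ω) ∂P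
      = ∫ ω, responseDeriv m π (D ω) (X ω) (ε ω) ∂P := by
    rw [hrint, ← integral_congr_ae hmean,
      integral_map hDX.aemeasurable hmi.aestronglyMeasurable]
  have heffect := isMarginalPolicyEffect_integral_responseDeriv hS hR hYt hY
  refine ⟨?_, ?_, ?_, hβint.symm ▸ heffect, hmint.symm ▸ heffect⟩
  · rw [← hκ'] at hπβ
    exact (integrable_map_measure hπβ.aestronglyMeasurable hDXε.aemeasurable).1 hπβ
  · filter_upwards [ae_of_ae_map hDX.aemeasurable hsupp] with ω hω
    exact (hasDerivAt_condMean hS hCI hC hcond hω.1 hω.2).2.2.differentiableAt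
  · exact (integrable_map_measure hmi.aestronglyMeasurable hDX.aemeasurable).1 hmi
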